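/- Let $0<p<2$. Let $X, X_1, X_2, \dots$ be identically distributed real-valued random variables on a probability space $(\Omega,\mathcal F,\mathbb P)$ with $X_1, X_2, \dots$ independent, and put $S_n = X_1+\dots+X_n$. Define, with $\log 0=-\infty$, $$\bar\beta = -\limsup_{t\to\infty}\frac1t\log\mathbb P(\log|X|>t)\in[0,\infty],\qquad \underline\beta = -\liminf_{t\to\infty}\frac1t\log\mathbb P(\log|X|>t)\in[0,\infty].$$ Suppose that * if $0<p<1$: $\displaystyle\lim_{n\to\infty} n\,\mathbb P(|X|>n^{1/p})=0$; * if $p=1$: $\displaystyle\lim_{n\to\infty}\bigl(\,\bigl|\mathbb E[X\,I(|X|\le n)]\bigr| + n\,\mathbb P(|X|>n)\bigr)=0$; * if $1<p<2$: $\mathbb E X=0$ (with $X$ integrable) and $\displaystyle\lim_{n\to\infty} n\,\mathbb P(|X|>n^{1/p})=0$. Then, for every $s>0$, $$\limsup_{n\to\infty}\frac1{\log n}\log\mathbb P\bigl(|S_n|>s\,n^{1/p}\bigr) = -(\bar\beta-p)/p,\qquad \liminf_{n\to\infty}\frac1{\log n}\log\mathbb P\bigl(|S_n|>s\,n^{1/p}\bigr)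 = -(\underline\beta-p)/p,$$ where $(\pm\infty-p)/p=\pm\infty$. Moreover, for every $s>0$ and every $\hat\beta\in[-\infty,\infty]$, $$\lim_{n\to\infty}\frac1{\log n}\log\mathbb P\bigl(|S_n|>s\,n^{1/p}\bigr) = -(\hat\beta-p)/p \quad\text{if and only if}\quad \bar\beta=\underline\beta=\hat\beta.$$ -/

import Mathlib

open MeasureTheory ProbabilityTheory Filter Topology

/-- `(1 / t) * log P(log |X| > t)` as an extended real (`ENNReal.log 0 = ⊥`). Only large `t` matter
below; for `t ≥ 0` the convention `Real.log 0 = 0` gives the same event as `log 0 = -∞`. -/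
noncomputable def logTailRate {Ω : Type*} [MeasurableSpace Ω] (P : Measure Ω) (X : Ω → ℝ)
    (t : ℝ) : EReal :=
  ((1 / t : ℝ) : EReal) * ENNReal.log (P {ω | t < Real.log |X ω|})

/-- `β̄ = - limsup_{t → ∞} (1 / t) log P(log |X| > t)`. -/
noncomputable def betaUpper {Ω : Type*} [MeasurableSpace Ω] (P : Measure Ω) (X : Ω → ℝ) : EReal :=
  -limsup (fun t : ℝ => logTailRate P X t) atTop

/-- `β_ = - liminf_{t → ∞} (1 / t) log P(log |X| > t)`. -/
noncomputable def betaLower {Ω : Type*} [MeasurableSpace Ω] (P : Measure Ω) (X : Ω → ℝ) : EReal :=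
  -liminf (fun t : ℝ => logTailRate P X t) atTop

/-- The Kolmogorov-Feller weak law conditions with exponent `p`. -/
def WeakLawCondition {Ω : Type*} [MeasurableSpace Ω] (P : Measure Ω) (X : Ω → ℝ) (p : ℝ) : Prop :=
  (p < 1 →
    Tendsto (fun n : ℕ => (n : ℝ) * P.real {ω | (n : ℝ) ^ (1 / p) < |X ω|}) atTop (𝓝 0)) ∧
  (p = 1 →
    Tendsto (fun n : ℕ => |∫ ω in {ω | |X ω| ≤ (n : ℝ)}, X ω ∂P| +
      (n : ℝ) * P.real {ω | (n : ℝ) < |X ω|}) atTop (𝓝 0)) ∧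
  (1 < p →
    (Integrable X P ∧ ∫ ω, X ω ∂P = 0) ∧
    Tendsto (fun n : ℕ => (n : ℝ) * P.real {ω | (n : ℝ) ^ (1 / p) < |X ω|}) atTop (𝓝 0))

/-- The partial sum of the first `n` terms of the sequence, which is numbered from `0`. -/
def partialSum {Ω : Type*} (Xs : ℕ → Ω → ℝ) (n : ℕ) (ω : Ω) : ℝ :=
  ∑ i ∈ Finset.range n, Xs i ω

/-- `(1 / log n) * log P(|S_n| > s n^{1/p})` as an extended real. -/
noncomputable def logDeviationRate {Ω : Type*} [MeasurableSpace Ω] (P : Measure Ω)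
    (Xs : ℕ → Ω → ℝ) (p s : ℝ) (n : ℕ) : EReal :=
  ((1 / Real.log n : ℝ) : EReal) *
    ENNReal.log (P {ω | s * (n : ℝ) ^ (1 / p) < |partialSum Xs n ω|})

/-!
Truncate the summands at a level `b` and apply Chernoff's bound to what remains. At
`b = n ^ (k / p)` with `k < 1` the truncated sum exceeds `s * n ^ (1 / p)` with probability smaller
than any power of `n`, so `P(|S_n| > s n^{1/p})` is at most of order `n * P(|X| > n ^ (k / p))`. At
`b = n ^ (1 / p)` the same bound shows that sums of at most `n` terms are of order `n ^ (1 / p)`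
with probability bounded below; hence a single summand beyond `(s + 4) * n ^ (1 / p)` is usually not
compensated by the others, and `P(|S_n| > s n^{1/p})` is at least of order
`n * P(|X| > (s + 4) * n ^ (1 / p))`. On the logarithmic scale the two bounds agree as `k → 1`, and
monotonicity of the tail makes its decay rates along `t = α * log n` those along real `t`.
-/

/-- The truncation of `x` at level `b`. Unlike `ProbabilityTheory.truncation`, which keeps the
values in `(-b, b]`, it keeps the symmetric closed interval that `WeakLawCondition` uses for
`p = 1`. -/
noncomputable def trunc (b x : ℝ) : ℝ := if |x| ≤ b then x else 0

lemma trunc_of_abs_le {b x : ℝ} (h : |x| ≤ b) : trunc b x = x := if_pos h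

lemma trunc_of_lt_abs {b x : ℝ} (h : b < |x|) : trunc b x = 0 := if_neg h.not_ge

lemma measurable_trunc (b : ℝ) : Measurable (trunc b) :=
  measurable_id.indicator (measurableSet_le measurable_abs measurable_const)

lemma abs_trunc_le (b x : ℝ) : |trunc b x| ≤ |b| := by
  unfold trunc
  split_ifs with h
  · exact h.trans (le_abs_self b)
  · simp

lemma abs_trunc_le_abs (b x : ℝ) : |trunc b x| ≤ |x| := by
  unfold trunc
  split_ifs <;> simp

lemma trunc_sq_sq {b : ℝ} (hb : 0 ≤ b) (x : ℝ) : trunc (b ^ 2) (x ^ 2) = trunc b x ^ 2 := by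
  simp only [trunc, abs_pow, sq_le_sq₀ (abs_nonneg x) hb, ite_pow, zero_pow two_ne_zero]

section

variable {Ω : Type*} [MeasurableSpace Ω] {P : Measure Ω}

lemma integrable_trunc [IsFiniteMeasure P] {X : Ω → ℝ} (hX : AEMeasurable X P) (b : ℝ) :
    Integrable (fun ω => trunc b (X ω)) P :=
  Integrable.of_bound ((measurable_trunc b).comp_aemeasurable hX).aestronglyMeasurable |b|
    (ae_of_all _ fun ω => abs_trunc_le b (X ω))

lemma identDistrib_measureReal_lt_abs {X Y : Ω → ℝ} (h : IdentDistrib X Y P P) (t : ℝ) :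
    P.real {ω | t < |X ω|} = P.real {ω | t < |Y ω|} :=
  congrArg ENNReal.toReal
    (h.measure_mem_eq (s := {x | t < |x|}) (measurableSet_lt measurable_const measurable_abs))

lemma nullMeasurableSet_lt_abs {Y : Ω → ℝ} (hY : AEMeasurable Y P) (t : ℝ) :
    NullMeasurableSet {ω | t < |Y ω|} P :=
  nullMeasurableSet_lt aemeasurable_const hY.abs

lemma measureReal_lt_abs_inter_lt_abs_eq_mul {Y Z : Ω → ℝ} (hYZ : IndepFun Y Z P) (s t : ℝ) :
    P.real ({ω | s < |Y ω|} ∩ {ω | t < |Z ω|}) =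
      P.real {ω | s < |Y ω|} * P.real {ω | t < |Z ω|} := by
  have habs (c : ℝ) : MeasurableSet {x : ℝ | c < |x|} :=
    measurableSet_lt measurable_const measurable_abs
  rw [measureReal_def, measureReal_def, measureReal_def, ← ENNReal.toReal_mul]
  exact congrArg ENNReal.toReal (hYZ.measure_inter_preimage_eq_mul _ _ (habs s) (habs t))

end

section

variable {Ω ι : Type*} [MeasurableSpace Ω] {P : Measure Ω}

lemma mgf_le_exp_of_abs_le [IsProbabilityMeasure P] {Y : Ω → ℝ} (hY : AEMeasurable Y P) {l b : ℝ}
    (hb : ∀ᵐ ω ∂P, |Y ω| ≤ b) (hlb : |l| * b ≤ 1) :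
    mgf Y P l ≤ Real.exp (l * ∫ ω, Y ω ∂P + l ^ 2 * ∫ ω, Y ω ^ 2 ∂P) := by
  have hYi : Integrable Y P := .of_bound hY.aestronglyMeasurable b hb
  have hYi2 : Integrable (fun ω => Y ω ^ 2) P := by
    refine .of_bound (hY.pow_const 2).aestronglyMeasurable (b ^ 2) ?_
    filter_upwards [hb] with ω hω
    rw [norm_pow]
    exact pow_le_pow_left₀ (norm_nonneg _) hω 2
  have hquad : Integrable (fun ω => l * Y ω + l ^ 2 * Y ω ^ 2) P :=
    (hYi.const_mul l).add (hYi2.const_mul (l ^ 2))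
  have hexp : Integrable (fun ω => Real.exp (l * Y ω)) P :=
    integrable_exp_mul_of_mem_Icc hY (hb.mono fun _ => abs_le.1)
  calc mgf Y P l ≤ ∫ ω, (1 + (l * Y ω + l ^ 2 * Y ω ^ 2)) ∂P := by
        refine integral_mono_ae hexp ((integrable_const _).add hquad) ?_
        filter_upwards [hb] with ω hω
        have hlY : |l * Y ω| ≤ 1 := by
          rw [abs_mul]
          exact (mul_le_mul_of_nonneg_left hω (abs_nonneg l)).trans hlb
        linarith [(abs_le.1 (Real.abs_exp_sub_one_sub_id_le hlY)).2, mul_pow l (Y ω) 2]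
    _ = l * ∫ ω, Y ω ∂P + l ^ 2 * ∫ ω, Y ω ^ 2 ∂P + 1 := by
        rw [integral_add (integrable_const _) hquad, integral_add (hYi.const_mul _)
          (hYi2.const_mul _), integral_const_mul, integral_const_mul, integral_const,
          probReal_univ, one_smul, add_comm]
    _ ≤ _ := Real.add_one_le_exp _

lemma measureReal_le_sum_le_exp [IsProbabilityMeasure P] {Y : ι → Ω → ℝ} (hindep : iIndepFun Y P)
    (hY : ∀ i, AEMeasurable (Y i) P) (F : Finset ι) {b l : ℝ}
    (hb : ∀ i ∈ F, ∀ᵐ ω ∂P, |Y i ω| ≤ b) (hl : 0 ≤ l) (hlb : l * b ≤ 1) (t : ℝ) :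
    P.real {ω | t ≤ ∑ i ∈ F, Y i ω} ≤
      Real.exp (-(l * t) + ∑ i ∈ F, (l * ∫ ω, Y i ω ∂P + l ^ 2 * ∫ ω, Y i ω ^ 2 ∂P)) := by
  have hexp : Integrable (fun ω => Real.exp (l * (∑ i ∈ F, Y i) ω)) P := by
    refine integrable_exp_mul_of_mem_Icc (a := -(F.card • b)) (b := F.card • b)
      (F.aemeasurable_sum fun i _ => hY i) ?_
    filter_upwards [(ae_ball_iff F.countable_toSet).2 hb] with ω hω
    rw [Finset.sum_apply]
    exact abs_le.1 <| (F.abs_sum_le_sum_abs _).trans (F.sum_le_card_nsmul _ _ hω)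
  have hmgf : mgf (∑ i ∈ F, Y i) P l ≤
      Real.exp (∑ i ∈ F, (l * ∫ ω, Y i ω ∂P + l ^ 2 * ∫ ω, Y i ω ^ 2 ∂P)) := by
    rw [hindep.mgf_sum₀ hY, Real.exp_sum]
    exact Finset.prod_le_prod (fun i _ => mgf_nonneg) fun i hi =>
      mgf_le_exp_of_abs_le (hY i) (hb i hi) (by rwa [abs_of_nonneg hl])
  calc P.real {ω | t ≤ ∑ i ∈ F, Y i ω} = P.real {ω | t ≤ (∑ i ∈ F, Y i) ω} := by
        simp only [Finset.sum_apply]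
    _ ≤ Real.exp (-l * t) * mgf (∑ i ∈ F, Y i) P l := measure_ge_le_exp_mul_mgf t hl hexp
    _ ≤ _ := by
        rw [neg_mul, Real.exp_add]
        gcongr

lemma measureReal_lt_abs_sum_le_exp [IsProbabilityMeasure P] {Y : ι → Ω → ℝ}
    (hindep : iIndepFun Y P) (hY : ∀ i, AEMeasurable (Y i) P) (F : Finset ι) {b l : ℝ}
    (hb : ∀ i ∈ F, ∀ᵐ ω ∂P, |Y i ω| ≤ b) (hl : 0 ≤ l) (hlb : l * b ≤ 1) (t : ℝ) :
    P.real {ω | t < |∑ i ∈ F, Y i ω|} ≤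
      2 * Real.exp (-(l * t) + ∑ i ∈ F, (l * |∫ ω, Y i ω ∂P| + l ^ 2 * ∫ ω, Y i ω ^ 2 ∂P)) := by
  have hpos : P.real {ω | t ≤ ∑ i ∈ F, Y i ω} ≤
      Real.exp (-(l * t) + ∑ i ∈ F, (l * |∫ ω, Y i ω ∂P| + l ^ 2 * ∫ ω, Y i ω ^ 2 ∂P)) := by
    refine (measureReal_le_sum_le_exp hindep hY F hb hl hlb t).trans ?_
    gcongr
    exact le_abs_self _
  have hneg : P.real {ω | t ≤ ∑ i ∈ F, -Y i ω} ≤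
      Real.exp (-(l * t) + ∑ i ∈ F, (l * |∫ ω, Y i ω ∂P| + l ^ 2 * ∫ ω, Y i ω ^ 2 ∂P)) := by
    have hindep' : iIndepFun (fun i ω => -Y i ω) P :=
      hindep.comp (fun _ x => -x) fun _ => measurable_neg
    refine (measureReal_le_sum_le_exp hindep' (fun i => (hY i).neg) F
      (by simpa only [abs_neg] using hb) hl hlb t).trans ?_
    simp only [integral_neg, neg_sq]
    gcongr
    exact neg_le_abs _
  have hsub : {ω | t < |∑ i ∈ F, Y i ω|} ⊆
      {ω | t ≤ ∑ i ∈ F, Y i ω} ∪ {ω | t ≤ ∑ i ∈ F, -Y i ω} := fun ω hω =>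
    (lt_abs.1 hω).imp le_of_lt fun h => by
      simpa only [Set.mem_ofPred_eq, Finset.sum_neg_distrib] using h.le
  linarith [measureReal_mono hsub (μ := P), measureReal_union_le (μ := P)
    {ω | t ≤ ∑ i ∈ F, Y i ω} {ω | t ≤ ∑ i ∈ F, -Y i ω}]

lemma measureReal_lt_abs_sum_le_add_trunc [IsFiniteMeasure P] (Xs : ι → Ω → ℝ) (F : Finset ι)
    (b t : ℝ) :
    P.real {ω | t < |∑ i ∈ F, Xs i ω|} ≤
      ∑ i ∈ F, P.real {ω | b < |Xs i ω|} + P.real {ω | t < |∑ i ∈ F, trunc b (Xs i ω)|} := by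
  have hsub : {ω | t < |∑ i ∈ F, Xs i ω|} ⊆
      (⋃ i ∈ F, {ω | b < |Xs i ω|}) ∪ {ω | t < |∑ i ∈ F, trunc b (Xs i ω)|} := by
    intro ω hω
    by_cases h : ∃ i ∈ F, b < |Xs i ω|
    · exact .inl (by simpa using h)
    · push Not at h
      refine .inr ?_
      rwa [Set.mem_ofPred_eq, F.sum_congr rfl fun i hi => trunc_of_abs_le (h i hi)]
  calc P.real {ω | t < |∑ i ∈ F, Xs i ω|}
      ≤ P.real (⋃ i ∈ F, {ω | b < |Xs i ω|}) + P.real {ω | t < |∑ i ∈ F, trunc b (Xs i ω)|} :=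
        (measureReal_mono hsub).trans (measureReal_union_le _ _)
    _ ≤ _ := by
        gcongr
        exact measureReal_biUnion_finset_le F _

lemma measureReal_lt_abs_sum_le_of_identDistrib [IsProbabilityMeasure P] {X : Ω → ℝ}
    {Xs : ι → Ω → ℝ} (hindep : iIndepFun Xs P) (hident : ∀ i, IdentDistrib (Xs i) X P P)
    {F : Finset ι} {n : ℕ} (hF : F.card ≤ n) {b l : ℝ} (hb : 0 ≤ b) (hl : 0 ≤ l)
    (hlb : l * b ≤ 1) (t : ℝ) :
    P.real {ω | t < |∑ i ∈ F, Xs i ω|} ≤ n * P.real {ω | b < |X ω|} +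
      2 * Real.exp (-(l * t) + n * (l * |∫ ω, trunc b (X ω) ∂P|
        + l ^ 2 * ∫ ω, trunc b (X ω) ^ 2 ∂P)) := by
  have htrunc (i : ι) : IdentDistrib (fun ω => trunc b (Xs i ω)) (fun ω => trunc b (X ω)) P P :=
    (hident i).comp (measurable_trunc b)
  have hchernoff := measureReal_lt_abs_sum_le_exp
    (hindep.comp (fun _ => trunc b) fun _ => measurable_trunc b)
    (fun i => (htrunc i).aemeasurable_fst) F
    (fun i _ => ae_of_all _ fun ω => (abs_trunc_le b (Xs i ω)).trans_eq (abs_of_nonneg hb))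
    hl hlb t
  simp only [Function.comp_apply, (htrunc _).integral_eq, (htrunc _).sq.integral_eq,
    Finset.sum_const, nsmul_eq_mul] at hchernoff
  refine (measureReal_lt_abs_sum_le_add_trunc Xs F b t).trans ?_
  simp only [identDistrib_measureReal_lt_abs (hident _), Finset.sum_const, nsmul_eq_mul]
  refine add_le_add (by gcongr) (hchernoff.trans ?_)
  have : 0 ≤ ∫ ω, trunc b (X ω) ^ 2 ∂P := integral_nonneg fun _ => sq_nonneg _
  gcongr

end

section

variable {Ω ι : Type*} [DecidableEq ι]

/-- The event that `Xs i` is the only summand of `∑ j ∈ F, Xs j` beyond `u + v` in absolute value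
and that the other summands add up to at most `v`: one big jump carries the sum beyond `u`. -/
def loneJump (Xs : ι → Ω → ℝ) (F : Finset ι) (u v : ℝ) (i : ι) : Set Ω :=
  {ω | u + v < |Xs i ω|} \
    ({ω | v < |∑ j ∈ F.erase i, Xs j ω|} ∪ ⋃ j ∈ F.erase i, {ω | u + v < |Xs j ω|})

lemma loneJump_subset (Xs : ι → Ω → ℝ) {F : Finset ι} (u v : ℝ) {i : ι} (hi : i ∈ F) :
    loneJump Xs F u v i ⊆ {ω | u < |∑ j ∈ F, Xs j ω|} := by
  rintro ω ⟨hjump, hrest⟩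
  have hjump : u + v < |Xs i ω| := hjump
  have hrest : |∑ j ∈ F.erase i, Xs j ω| ≤ v := not_lt.1 fun h => hrest (.inl h)
  have htriangle := abs_sub_abs_le_abs_sub (Xs i ω) (-∑ j ∈ F.erase i, Xs j ω)
  rw [sub_neg_eq_add, abs_neg, F.add_sum_erase (fun j => Xs j ω) hi] at htriangle
  change u < |∑ j ∈ F, Xs j ω|
  linarith

lemma pairwiseDisjoint_loneJump (Xs : ι → Ω → ℝ) (F : Finset ι) (u v : ℝ) :
    (F : Set ι).PairwiseDisjoint (loneJump Xs F u v) := by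
  refine fun i hi j _ hij => Set.disjoint_left.2 fun ω hωi hωj => hωj.2 (.inr ?_)
  exact Set.mem_biUnion (Finset.mem_coe.2 (Finset.mem_erase.2 ⟨hij, hi⟩)) hωi.1

variable [MeasurableSpace Ω] {P : Measure Ω}

lemma nullMeasurableSet_loneJump {Xs : ι → Ω → ℝ} (hXs : ∀ i, AEMeasurable (Xs i) P)
    (F : Finset ι) (u v : ℝ) (i : ι) : NullMeasurableSet (loneJump Xs F u v i) P :=
  (nullMeasurableSet_lt_abs (hXs i) _).diff <|
    (nullMeasurableSet_lt_abs (Finset.aemeasurable_fun_sum _ fun j _ => hXs j) _).union <|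
      .biUnion (Finset.countable_toSet _) fun j _ => nullMeasurableSet_lt_abs (hXs j) _

lemma half_measureReal_le_measureReal_loneJump [IsFiniteMeasure P] {Xs : ι → Ω → ℝ}
    (hXs : ∀ i, AEMeasurable (Xs i) P) (hindep : iIndepFun Xs P) {F : Finset ι} {u v : ℝ} (i : ι)
    (hjump : ∑ j ∈ F, P.real {ω | u + v < |Xs j ω|} ≤ 1 / 4)
    (hrest : P.real {ω | v < |∑ j ∈ F.erase i, Xs j ω|} ≤ 1 / 4) :
    1 / 2 * P.real {ω | u + v < |Xs i ω|} ≤ P.real (loneJump Xs F u v i) := by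
  set B : ι → Set Ω := fun j => {ω | u + v < |Xs j ω|}
  set C : Set Ω := {ω | v < |∑ j ∈ F.erase i, Xs j ω|}
  have hothers : P.real (B i ∩ ⋃ j ∈ F.erase i, B j) ≤ P.real (B i) * (1 / 4) := by
    calc P.real (B i ∩ ⋃ j ∈ F.erase i, B j) = P.real (⋃ j ∈ F.erase i, B i ∩ B j) := by
          rw [Set.inter_iUnion₂]
      _ ≤ ∑ j ∈ F.erase i, P.real (B i ∩ B j) := measureReal_biUnion_finset_le _ _
      _ = P.real (B i) * ∑ j ∈ F.erase i, P.real (B j) := by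
          rw [Finset.mul_sum]
          exact Finset.sum_congr rfl fun j hj => measureReal_lt_abs_inter_lt_abs_eq_mul
            (hindep.indepFun (Finset.ne_of_mem_erase hj).symm) _ _
      _ ≤ P.real (B i) * ∑ j ∈ F, P.real (B j) := by
          gcongr
          exact F.erase_subset i
      _ ≤ P.real (B i) * (1 / 4) := by gcongr
  have hsum : P.real (B i ∩ C) ≤ P.real (B i) * (1 / 4) := by
    have hind : IndepFun (Xs i) (fun ω => ∑ j ∈ F.erase i, Xs j ω) P := by
      simpa only [Finset.sum_fn] using
        (hindep.indepFun_finsetSum_of_notMem₀ hXs (F.notMem_erase i)).symm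
    rw [measureReal_lt_abs_inter_lt_abs_eq_mul hind]
    gcongr
  have hcover : B i ⊆ loneJump Xs F u v i ∪ (B i ∩ C ∪ B i ∩ ⋃ j ∈ F.erase i, B j) := by
    rw [← Set.inter_union_distrib_left]
    exact (Set.sdiff_union_inter _ _).ge
  linarith [measureReal_mono (μ := P) hcover,
    measureReal_union_le (μ := P) (loneJump Xs F u v i) (B i ∩ C ∪ B i ∩ ⋃ j ∈ F.erase i, B j),
    measureReal_union_le (μ := P) (B i ∩ C) (B i ∩ ⋃ j ∈ F.erase i, B j)]

lemma half_sum_measureReal_lt_abs_le [IsFiniteMeasure P] {Xs : ι → Ω → ℝ}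
    (hXs : ∀ i, AEMeasurable (Xs i) P) (hindep : iIndepFun Xs P) {F : Finset ι} {u v : ℝ}
    (hjump : ∑ i ∈ F, P.real {ω | u + v < |Xs i ω|} ≤ 1 / 4)
    (hrest : ∀ i ∈ F, P.real {ω | v < |∑ j ∈ F.erase i, Xs j ω|} ≤ 1 / 4) :
    1 / 2 * ∑ i ∈ F, P.real {ω | u + v < |Xs i ω|} ≤ P.real {ω | u < |∑ i ∈ F, Xs i ω|} := by
  calc 1 / 2 * ∑ i ∈ F, P.real {ω | u + v < |Xs i ω|}
      ≤ ∑ i ∈ F, P.real (loneJump Xs F u v i) := by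
        rw [Finset.mul_sum]
        exact Finset.sum_le_sum fun i hi =>
          half_measureReal_le_measureReal_loneJump hXs hindep i hjump (hrest i hi)
    _ = P.real (⋃ i ∈ F, loneJump Xs F u v i) :=
        (measureReal_biUnion_finset₀ (pairwiseDisjoint_loneJump Xs F u v).aedisjoint
          fun i _ => nullMeasurableSet_loneJump hXs F u v i).symm
    _ ≤ _ := measureReal_mono (Set.iUnion₂_subset fun i hi => loneJump_subset Xs u v hi)

end

section

variable {Ω : Type*} [MeasurableSpace Ω] {P : Measure Ω}

lemma integral_abs_le_setIntegral_add_setIntegral {Y : Ω → ℝ} (hY : Integrable Y P)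
    {f g : ℝ → ℝ} {c : ℝ} (hc : 0 ≤ c) (hf : IntegrableOn f (Set.Ioc 0 c))
    (hg : IntegrableOn g (Set.Ioi c)) (hYf : ∀ t ∈ Set.Ioc 0 c, P.real {ω | t < |Y ω|} ≤ f t)
    (hYg : ∀ t ∈ Set.Ioi c, P.real {ω | t < |Y ω|} ≤ g t) :
    ∫ ω, |Y ω| ∂P ≤ (∫ t in Set.Ioc 0 c, f t) + ∫ t in Set.Ioi c, g t := by
  have hsplit : Set.Ioi 0 = Set.Ioc 0 c ∪ Set.Ioi c := (Set.Ioc_union_Ioi_eq_Ioi hc).symm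
  have hdisj : Disjoint (Set.Ioc 0 c) (Set.Ioi c) :=
    Set.disjoint_left.2 fun _ ht ht' => ht.2.not_gt ht'
  set h : ℝ → ℝ := (Set.Ioc 0 c).piecewise f g
  have hhf : Set.EqOn h f (Set.Ioc 0 c) := Set.piecewise_eqOn _ _ _
  have hhg : Set.EqOn h g (Set.Ioi c) := fun t ht =>
    Set.piecewise_eq_of_notMem _ _ _ (hdisj.notMem_of_mem_right ht)
  have hf' : IntegrableOn h (Set.Ioc 0 c) := hf.congr_fun hhf.symm measurableSet_Ioc
  have hg' : IntegrableOn h (Set.Ioi c) := hg.congr_fun hhg.symm measurableSet_Ioi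
  calc ∫ ω, |Y ω| ∂P = ∫ t in Set.Ioi 0, P.real {ω | t < |Y ω|} :=
        hY.abs.integral_eq_integral_meas_lt (ae_of_all _ fun _ => abs_nonneg _)
    _ ≤ ∫ t in Set.Ioi 0, h t := by
        refine integral_mono_of_nonneg (ae_of_all _ fun _ => measureReal_nonneg)
          (hsplit ▸ hf'.union hg') (ae_restrict_of_forall_mem measurableSet_Ioi fun t ht => ?_)
        rcases hsplit ▸ ht with ht | ht
        · exact (hYf t ht).trans_eq (hhf ht).symm
        · exact (hYg t ht).trans_eq (hhg ht).symm
    _ = (∫ t in Set.Ioc 0 c, f t) + ∫ t in Set.Ioi c, g t := by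
        rw [hsplit, setIntegral_union hdisj measurableSet_Ioi hf' hg',
          setIntegral_congr_fun measurableSet_Ioc hhf, setIntegral_congr_fun measurableSet_Ioi hhg]

lemma integral_abs_trunc_le [IsProbabilityMeasure P] {X : Ω → ℝ} (hX : AEMeasurable X P)
    {p ε b T : ℝ} (hp : p < 1) (hε : 0 ≤ ε) (hT : 0 ≤ T) (hTb : T ≤ b)
    (htail : ∀ t, T < t → P.real {ω | t < |X ω|} ≤ ε * t ^ (-p)) :
    ∫ ω, |trunc b (X ω)| ∂P ≤ T + ε / (1 - p) * b ^ (1 - p) := by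
  have hint : IntegrableOn (fun t : ℝ => ε * t ^ (-p)) (Set.Ioc T b) :=
    (intervalIntegrable_iff_integrableOn_Ioc_of_le hTb).1
      ((intervalIntegral.intervalIntegrable_rpow' (by linarith)).const_mul ε)
  calc ∫ ω, |trunc b (X ω)| ∂P
      ≤ (∫ _ in Set.Ioc 0 T, 1) +
          ∫ t in Set.Ioi T, (Set.Iic b).indicator (fun t => ε * t ^ (-p)) t := by
        refine integral_abs_le_setIntegral_add_setIntegral (integrable_trunc hX b) hT
          (integrableOn_const (by simp))
          ((integrable_indicator_iff measurableSet_Iic).2 ?_) (fun _ _ => measureReal_le_one)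
          fun t ht => ?_
        · rwa [IntegrableOn, Measure.restrict_restrict measurableSet_Iic, Set.inter_comm,
            Set.Ioi_inter_Iic]
        rcases le_or_gt t b with htb | htb
        · rw [Set.indicator_of_mem (Set.mem_Iic.2 htb)]
          exact (measureReal_mono fun ω hω =>
            hω.trans_le (abs_trunc_le_abs b (X ω))).trans (htail t ht)
        · have hempty : {ω | t < |trunc b (X ω)|} = ∅ := Set.eq_empty_of_forall_notMem fun ω hω =>
            ((abs_trunc_le b (X ω)).trans_eq (abs_of_nonneg (hT.trans hTb))).not_gt (htb.trans hω)
          rw [hempty, measureReal_empty, Set.indicator_of_notMem (Set.notMem_Iic.2 htb)]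
    _ = T + ε / (1 - p) * (b ^ (1 - p) - T ^ (1 - p)) := by
        rw [setIntegral_indicator measurableSet_Iic, Set.Ioi_inter_Iic,
          ← intervalIntegral.integral_of_le hTb, intervalIntegral.integral_const_mul,
          integral_rpow (.inl (by linarith)), neg_add_eq_sub, setIntegral_const, measureReal_def,
          Real.volume_Ioc, sub_zero, ENNReal.toReal_ofReal hT, smul_eq_mul]
        ring
    _ ≤ _ := by
        have := sub_pos.2 hp
        have := Real.rpow_nonneg hT (1 - p)
        gcongr
        linarith

lemma integral_abs_sub_trunc_le [IsFiniteMeasure P] {X : Ω → ℝ} (hX : Integrable X P)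
    {p ε b : ℝ} (hp : 1 < p) (hb : 0 < b)
    (htail : ∀ t, b ≤ t → P.real {ω | t < |X ω|} ≤ ε * t ^ (-p)) :
    ∫ ω, |X ω - trunc b (X ω)| ∂P ≤ ε * (1 + 1 / (p - 1)) * b ^ (1 - p) := by
  have hsub (t : ℝ) (ht : 0 < t) : {ω | t < |X ω - trunc b (X ω)|} ⊆ {ω | max b t < |X ω|} := by
    intro ω hω
    rcases le_or_gt |X ω| b with h | h
    · rw [Set.mem_ofPred_eq, trunc_of_abs_le h, sub_self, abs_zero] at hω
      exact absurd hω ht.not_gt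
    · rw [Set.mem_ofPred_eq, trunc_of_lt_abs h, sub_zero] at hω
      exact max_lt h hω
  calc ∫ ω, |X ω - trunc b (X ω)| ∂P
      ≤ (∫ _ in Set.Ioc 0 b, ε * b ^ (-p)) + ∫ t in Set.Ioi b, ε * t ^ (-p) := by
        refine integral_abs_le_setIntegral_add_setIntegral
          (hX.sub (integrable_trunc hX.aemeasurable b)) hb.le (integrableOn_const (by simp))
          ((integrableOn_Ioi_rpow_of_lt (by linarith) hb).const_mul ε) (fun t ht => ?_)
          fun t ht => ?_
        · have h := (measureReal_mono (hsub t ht.1)).trans (htail _ (le_max_left b t))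
          rwa [max_eq_left ht.2] at h
        · have h := (measureReal_mono (hsub t (hb.trans ht))).trans (htail _ (le_max_left b t))
          rwa [max_eq_right (le_of_lt ht)] at h
    _ = ε * (1 + 1 / (p - 1)) * b ^ (1 - p) := by
        have hb' : b * b ^ (-p) = b ^ (1 - p) := by
          rw [sub_eq_add_neg, Real.rpow_add hb, Real.rpow_one]
        rw [setIntegral_const, measureReal_def, Real.volume_Ioc, sub_zero,
          ENNReal.toReal_ofReal hb.le, smul_eq_mul, mul_left_comm, hb', integral_const_mul,
          integral_Ioi_rpow_of_lt (by linarith) hb, neg_add_eq_sub, ← neg_sub p 1, neg_div_neg_eq]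
        ring

lemma isLittleO_integral_abs_trunc [IsProbabilityMeasure P] {X : Ω → ℝ} (hX : AEMeasurable X P)
    {p : ℝ} (hp : p < 1) (htail : (fun t : ℝ => P.real {ω | t < |X ω|}) =o[atTop] (· ^ (-p))) :
    (fun b : ℝ => ∫ ω, |trunc b (X ω)| ∂P) =o[atTop] (· ^ (1 - p)) := by
  have hp' : 0 < 1 - p := sub_pos.2 hp
  refine Asymptotics.isLittleO_iff.2 fun ε hε => ?_
  obtain ⟨T, hT⟩ := eventually_atTop.1 (htail.def (c := ε / 2 * (1 - p)) (by positivity))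
  filter_upwards [eventually_ge_atTop (max T 0),
    ((tendsto_rpow_atTop hp').const_mul_atTop (half_pos hε)).eventually_ge_atTop (max T 0)]
    with b hTb hb
  have hb0 : 0 ≤ b := (le_max_right T 0).trans hTb
  have hmoment : ∫ ω, |trunc b (X ω)| ∂P ≤ max T 0 + ε / 2 * (1 - p) / (1 - p) * b ^ (1 - p) := by
    refine integral_abs_trunc_le hX hp (by positivity) (le_max_right T 0) hTb fun t ht => ?_
    have ht0 : 0 < t := (le_max_right T 0).trans_lt ht
    simpa only [Real.norm_of_nonneg measureReal_nonneg,
      Real.norm_of_nonneg (Real.rpow_nonneg ht0.le _)] using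
      hT t ((le_max_left T 0).trans ht.le)
  rw [Real.norm_of_nonneg (integral_nonneg fun _ => abs_nonneg _),
    Real.norm_of_nonneg (by positivity)]
  rw [mul_div_cancel_right₀ _ hp'.ne'] at hmoment
  linarith

lemma isLittleO_integral_trunc_sq [IsProbabilityMeasure P] {X : Ω → ℝ} (hX : AEMeasurable X P)
    {p : ℝ} (hp : p < 2) (htail : (fun t : ℝ => P.real {ω | t < |X ω|}) =o[atTop] (· ^ (-p))) :
    (fun b : ℝ => ∫ ω, trunc b (X ω) ^ 2 ∂P) =o[atTop] (· ^ (2 - p)) := by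
  have htail' : (fun t : ℝ => P.real {ω | t < |X ω ^ 2|}) =o[atTop] (· ^ (-(p / 2))) := by
    refine (htail.comp_tendsto (tendsto_rpow_atTop (y := 1 / 2) (by norm_num))).congr' ?_ ?_
      <;> filter_upwards [eventually_ge_atTop 0] with t ht
    · have hsqrt (x : ℝ) : t ^ (1 / 2 : ℝ) < |x| ↔ t < |x ^ 2| := by
        rw [← Real.sqrt_eq_rpow, ← Real.sqrt_sq_eq_abs, Real.sqrt_lt_sqrt_iff ht, abs_sq]
      simp only [Function.comp_apply, hsqrt]
    · rw [Function.comp_apply, ← Real.rpow_mul ht]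
      congr 1
      ring
  refine ((isLittleO_integral_abs_trunc (hX.pow_const 2) (by linarith) htail').comp_tendsto
    (tendsto_pow_atTop two_ne_zero)).congr' ?_ ?_
    <;> filter_upwards [eventually_ge_atTop 0] with b hb
  · simp only [Function.comp_apply, trunc_sq_sq hb, abs_sq]
  · rw [Function.comp_apply, ← Real.rpow_natCast, ← Real.rpow_mul hb]
    congr 1
    push_cast
    ring

lemma isLittleO_integral_abs_sub_trunc [IsFiniteMeasure P] {X : Ω → ℝ} (hX : Integrable X P)
    {p : ℝ} (hp : 1 < p) (htail : (fun t : ℝ => P.real {ω | t < |X ω|}) =o[atTop] (· ^ (-p))) :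
    (fun b : ℝ => ∫ ω, |X ω - trunc b (X ω)| ∂P) =o[atTop] (· ^ (1 - p)) := by
  have : 0 < p - 1 := sub_pos.2 hp
  refine Asymptotics.isLittleO_iff.2 fun ε hε => ?_
  obtain ⟨T, hT⟩ := eventually_atTop.1 (htail.def (c := ε / (1 + 1 / (p - 1))) (by positivity))
  filter_upwards [eventually_gt_atTop 0, eventually_ge_atTop T] with b hb0 hTb
  rw [Real.norm_of_nonneg (integral_nonneg fun _ => abs_nonneg _),
    Real.norm_of_nonneg (by positivity)]
  have hmoment := integral_abs_sub_trunc_le hX hp hb0 fun t ht => by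
    simpa only [Real.norm_of_nonneg measureReal_nonneg,
      Real.norm_of_nonneg (Real.rpow_nonneg (hb0.le.trans ht) _)] using hT t (hTb.trans ht)
  rwa [div_mul_cancel₀ _ (by positivity)] at hmoment

end

lemma tendsto_natCast_rpow_atTop {α : ℝ} (hα : 0 < α) :
    Tendsto (fun n : ℕ => (n : ℝ) ^ α) atTop atTop :=
  (tendsto_rpow_atTop hα).comp tendsto_natCast_atTop_atTop

section

variable {Ω : Type*} [MeasurableSpace Ω] {P : Measure Ω} {X : Ω → ℝ} {p : ℝ}

lemma isLittleO_tail_of_tendsto_mul [IsFiniteMeasure P] (hp : 0 < p)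
    (h : Tendsto (fun n : ℕ => (n : ℝ) * P.real {ω | (n : ℝ) ^ (1 / p) < |X ω|}) atTop (𝓝 0)) :
    (fun t : ℝ => P.real {ω | t < |X ω|}) =o[atTop] (· ^ (-p)) := by
  refine Asymptotics.isLittleO_iff.2 fun ε hε => ?_
  have hfloor : Tendsto (fun t : ℝ => ⌊t ^ p⌋₊) atTop atTop :=
    tendsto_nat_floor_atTop.comp (tendsto_rpow_atTop hp)
  filter_upwards [hfloor.eventually (h.eventually_le_const (half_pos hε)),
    eventually_ge_atTop 1] with t hn ht
  have ht0 : 0 < t := one_pos.trans_le ht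
  have htp : 1 ≤ t ^ p := Real.one_le_rpow ht hp.le
  have hfloor_le : (⌊t ^ p⌋₊ : ℝ) ^ (1 / p) ≤ t := by
    calc (⌊t ^ p⌋₊ : ℝ) ^ (1 / p) ≤ (t ^ p) ^ (1 / p) := by
          gcongr
          exact Nat.floor_le (by positivity)
      _ = t := by rw [← Real.rpow_mul ht0.le, mul_one_div_cancel hp.ne', Real.rpow_one]
  have hle_floor : t ^ p ≤ 2 * ⌊t ^ p⌋₊ := by
    have hpos : (1 : ℝ) ≤ ⌊t ^ p⌋₊ := by exact_mod_cast Nat.le_floor (by simpa using htp)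
    linarith [Nat.lt_floor_add_one (t ^ p)]
  have hmul : P.real {ω | t < |X ω|} * t ^ p ≤ ε := by
    calc P.real {ω | t < |X ω|} * t ^ p
        ≤ P.real {ω | (⌊t ^ p⌋₊ : ℝ) ^ (1 / p) < |X ω|} * (2 * ⌊t ^ p⌋₊) := by
          exact mul_le_mul (measureReal_mono fun ω hω => hfloor_le.trans_lt hω) hle_floor
            (by positivity) measureReal_nonneg
      _ ≤ ε := by linarith
  rw [Real.norm_of_nonneg measureReal_nonneg, Real.norm_of_nonneg (by positivity),
    Real.rpow_neg ht0.le, ← div_eq_mul_inv]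
  exact (le_div_iff₀ (by positivity)).2 hmul

lemma WeakLawCondition.tendsto_tail (h : WeakLawCondition P X p) :
    Tendsto (fun n : ℕ => (n : ℝ) * P.real {ω | (n : ℝ) ^ (1 / p) < |X ω|}) atTop (𝓝 0) := by
  rcases lt_trichotomy p 1 with hp | rfl | hp
  · exact h.1 hp
  · refine squeeze_zero (fun n => by positivity) (fun n => ?_) (h.2.1 rfl)
    simp only [div_one, Real.rpow_one]
    exact le_add_of_nonneg_left (abs_nonneg _)
  · exact (h.2.2 hp).2

lemma WeakLawCondition.isLittleO_tail [IsFiniteMeasure P] (h : WeakLawCondition P X p)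
    (hp : 0 < p) : (fun t : ℝ => P.real {ω | t < |X ω|}) =o[atTop] (· ^ (-p)) :=
  isLittleO_tail_of_tendsto_mul hp h.tendsto_tail

lemma WeakLawCondition.isLittleO_integral_trunc_of_ne_one [IsProbabilityMeasure P]
    (h : WeakLawCondition P X p) (hp : 0 < p) (hp1 : p ≠ 1) (hX : AEMeasurable X P) :
    (fun b : ℝ => ∫ ω, trunc b (X ω) ∂P) =o[atTop] (· ^ (1 - p)) := by
  rcases hp1.lt_or_gt with hp1 | hp1
  · refine (Asymptotics.isBigO_of_le _ fun b => ?_).trans_isLittleO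
      (isLittleO_integral_abs_trunc hX hp1 (h.isLittleO_tail hp))
    exact (norm_integral_le_integral_norm _).trans (le_abs_self _)
  · obtain ⟨⟨hXi, hX0⟩, -⟩ := h.2.2 hp1
    refine (Asymptotics.isBigO_of_le _ fun b => ?_).trans_isLittleO
      (isLittleO_integral_abs_sub_trunc hXi hp1 (h.isLittleO_tail hp))
    have hmean : ∫ ω, trunc b (X ω) ∂P = -∫ ω, (X ω - trunc b (X ω)) ∂P := by
      rw [integral_sub hXi (integrable_trunc hX b), hX0, zero_sub, neg_neg]
    rw [hmean, norm_neg]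
    exact (norm_integral_le_integral_norm _).trans (le_abs_self _)

lemma WeakLawCondition.tendsto_integral_trunc [IsFiniteMeasure P] (h : WeakLawCondition P X 1)
    (hX : AEMeasurable X P) : Tendsto (fun n : ℕ => ∫ ω, trunc n (X ω) ∂P) atTop (𝓝 0) := by
  refine squeeze_zero_norm (fun n => ?_) (h.2.1 rfl)
  have htrunc : ∫ ω, trunc n (X ω) ∂P = ∫ ω in {ω | |X ω| ≤ n}, X ω ∂P :=
    integral_indicator₀ (nullMeasurableSet_le hX.abs aemeasurable_const)
  rw [htrunc]
  exact le_add_of_nonneg_right (by positivity)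

lemma WeakLawCondition.isLittleO_integral_trunc [IsProbabilityMeasure P]
    (h : WeakLawCondition P X p) (hp : 0 < p) (hX : AEMeasurable X P) :
    (fun n : ℕ => (n : ℝ) * ∫ ω, trunc ((n : ℝ) ^ (1 / p)) (X ω) ∂P) =o[atTop]
      fun n : ℕ => (n : ℝ) ^ (1 / p) := by
  rcases eq_or_ne p 1 with rfl | hp1
  · simpa only [div_one, Real.rpow_one, mul_one] using
      (Asymptotics.isBigO_refl (fun n : ℕ => (n : ℝ)) atTop).mul_isLittleO
        ((Asymptotics.isLittleO_one_iff ℝ).2 (h.tendsto_integral_trunc hX))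
  · refine ((Asymptotics.isBigO_refl (fun n : ℕ => (n : ℝ)) atTop).mul_isLittleO
      ((h.isLittleO_integral_trunc_of_ne_one hp hp1 hX).comp_tendsto
        (tendsto_natCast_rpow_atTop (one_div_pos.2 hp)))).trans_eventuallyEq ?_
    filter_upwards [eventually_gt_atTop 0] with n hn
    have hn : (0 : ℝ) < n := Nat.cast_pos.2 hn
    have hexponent : 1 / p * (1 - p) = 1 / p - 1 := by field_simp
    rw [Function.comp_apply, ← Real.rpow_mul hn.le, hexponent, Real.rpow_sub_one hn.ne',
      mul_div_cancel₀ _ hn.ne']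

lemma WeakLawCondition.eventually_mul_abs_integral_trunc_le [IsProbabilityMeasure P]
    (h : WeakLawCondition P X p) (hp : 0 < p) (hX : AEMeasurable X P) {ε : ℝ} (hε : 0 < ε) :
    ∀ᶠ n : ℕ in atTop,
      n * |∫ ω, trunc ((n : ℝ) ^ (1 / p)) (X ω) ∂P| ≤ ε * (n : ℝ) ^ (1 / p) := by
  filter_upwards [(h.isLittleO_integral_trunc hp hX).def hε] with n hn
  rwa [norm_mul, RCLike.norm_natCast, Real.norm_eq_abs, Real.norm_of_nonneg (by positivity)] at hn

lemma abs_integral_trunc_le_add [IsFiniteMeasure P] (hX : AEMeasurable X P) {a b : ℝ}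
    (ha : 0 ≤ a) (hba : b ≤ a) :
    |∫ ω, trunc b (X ω) ∂P| ≤ |∫ ω, trunc a (X ω) ∂P| + a * P.real {ω | b < |X ω|} := by
  have hvanish : ∀ ω ∉ {ω | b < |X ω|}, trunc b (X ω) - trunc a (X ω) = 0 := by
    intro ω hω
    have hω : |X ω| ≤ b := not_lt.1 hω
    rw [trunc_of_abs_le hω, trunc_of_abs_le (hω.trans hba), sub_self]
  have hbound : ∀ ω ∈ {ω | b < |X ω|}, ‖trunc b (X ω) - trunc a (X ω)‖ ≤ a := by
    intro ω hω
    rw [trunc_of_lt_abs hω, zero_sub, norm_neg]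
    exact (abs_trunc_le a _).trans_eq (abs_of_nonneg ha)
  have hdiff : |∫ ω, (trunc b (X ω) - trunc a (X ω)) ∂P| ≤ a * P.real {ω | b < |X ω|} := by
    rw [← setIntegral_eq_integral_of_forall_compl_eq_zero hvanish]
    exact norm_setIntegral_le_of_norm_le_const (measure_lt_top P _) hbound
  rw [integral_sub (integrable_trunc hX b) (integrable_trunc hX a)] at hdiff
  linarith [abs_sub_abs_le_abs_sub (∫ ω, trunc b (X ω) ∂P) (∫ ω, trunc a (X ω) ∂P)]

end

section

variable {Ω : Type*} [MeasurableSpace Ω] {P : Measure Ω} [IsProbabilityMeasure P] {X : Ω → ℝ}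
  {Xs : ℕ → Ω → ℝ} {p s : ℝ}

lemma WeakLawCondition.eventually_integral_trunc_sq_le (h : WeakLawCondition P X p) (hp0 : 0 < p)
    (hp2 : p < 2) (hX : AEMeasurable X P) {α ε : ℝ} (hα : 0 < α) (hε : 0 < ε) :
    ∀ᶠ n : ℕ in atTop,
      ∫ ω, trunc ((n : ℝ) ^ α) (X ω) ^ 2 ∂P ≤ ε * (n : ℝ) ^ (α * (2 - p)) := by
  filter_upwards [(tendsto_natCast_rpow_atTop hα).eventually
    ((isLittleO_integral_trunc_sq hX hp2 (h.isLittleO_tail hp0)).def hε)] with n hn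
  rw [Real.rpow_mul (Nat.cast_nonneg n), ← Real.norm_of_nonneg (r := (_ ^ α) ^ _) (by positivity)]
  exact (le_abs_self _).trans hn

lemma measureReal_lt_abs_sum_le_one_fourth {ι : Type*} {Y : ι → Ω → ℝ}
    (hindep : iIndepFun Y P) (hident : ∀ i, IdentDistrib (Y i) X P P) {F : Finset ι} {n : ℕ}
    (hF : F.card ≤ n) {a : ℝ} (ha : 0 < a) (htail : n * P.real {ω | a < |X ω|} ≤ 1 / 8)
    (hmean : n * |∫ ω, trunc a (X ω) ∂P| ≤ 1 / 2 * a)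
    (hvar : n * ∫ ω, trunc a (X ω) ^ 2 ∂P ≤ 1 / 2 * a ^ 2) :
    P.real {ω | 4 * a < |∑ i ∈ F, Y i ω|} ≤ 1 / 4 := by
  have hmean' : n * (a⁻¹ * |∫ ω, trunc a (X ω) ∂P|) ≤ 1 / 2 := by
    calc n * (a⁻¹ * |∫ ω, trunc a (X ω) ∂P|) = a⁻¹ * (n * |∫ ω, trunc a (X ω) ∂P|) := by ring
      _ ≤ a⁻¹ * (1 / 2 * a) := by gcongr
      _ = 1 / 2 := by field_simp
  have hvar' : n * (a⁻¹ ^ 2 * ∫ ω, trunc a (X ω) ^ 2 ∂P) ≤ 1 / 2 := by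
    calc n * (a⁻¹ ^ 2 * ∫ ω, trunc a (X ω) ^ 2 ∂P)
        = a⁻¹ ^ 2 * (n * ∫ ω, trunc a (X ω) ^ 2 ∂P) := by ring
      _ ≤ a⁻¹ ^ 2 * (1 / 2 * a ^ 2) := by gcongr
      _ = 1 / 2 := by field_simp
  have hexponent : -(a⁻¹ * (4 * a)) + n * (a⁻¹ * |∫ ω, trunc a (X ω) ∂P| +
      a⁻¹ ^ 2 * ∫ ω, trunc a (X ω) ^ 2 ∂P) ≤ -3 := by
    have hlevel : a⁻¹ * (4 * a) = 4 := by field_simp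
    rw [hlevel, mul_add]
    linarith
  have hexp : Real.exp (-3) ≤ 1 / 16 := by
    rw [Real.exp_neg, ← one_div]
    gcongr
    calc (16 : ℝ) ≤ 2.7 ^ 3 := by norm_num
      _ ≤ Real.exp 1 ^ 3 := by
        gcongr
        linarith [Real.exp_one_gt_d9]
      _ = Real.exp 3 := by rw [← Real.exp_nat_mul]; norm_num
  refine (measureReal_lt_abs_sum_le_of_identDistrib hindep hident hF ha.le
    (inv_nonneg.2 ha.le) (inv_mul_cancel₀ ha.ne').le (4 * a)).trans ?_
  linarith [Real.exp_le_exp.2 hexponent]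

lemma WeakLawCondition.eventually_measureReal_lt_abs_sum_le (h : WeakLawCondition P X p)
    (hp0 : 0 < p) (hp2 : p < 2) (hindep : iIndepFun Xs P)
    (hident : ∀ i, IdentDistrib (Xs i) X P P) :
    ∀ᶠ n : ℕ in atTop, ∀ F : Finset ℕ, F.card ≤ n →
      P.real {ω | 4 * (n : ℝ) ^ (1 / p) < |∑ i ∈ F, Xs i ω|} ≤ 1 / 4 := by
  have hX : AEMeasurable X P := (hident 0).aemeasurable_snd
  filter_upwards [eventually_gt_atTop 0,
    h.tendsto_tail.eventually_le_const (by norm_num : (0 : ℝ) < 1 / 8),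
    h.eventually_mul_abs_integral_trunc_le hp0 hX one_half_pos,
    h.eventually_integral_trunc_sq_le hp0 hp2 hX (one_div_pos.2 hp0) one_half_pos]
    with n hn htail hmean hvar F hF
  have hn : (0 : ℝ) < n := Nat.cast_pos.2 hn
  have hscale : n * (n : ℝ) ^ (1 / p * (2 - p)) = ((n : ℝ) ^ (1 / p)) ^ 2 := by
    have hexponent : 1 + 1 / p * (2 - p) = 1 / p * 2 := by
      field_simp
      ring
    rw [← Real.rpow_one_add' hn.le (by rw [hexponent]; positivity), hexponent,
      Real.rpow_mul hn.le, Real.rpow_two]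
  refine measureReal_lt_abs_sum_le_one_fourth hindep hident hF (by positivity) htail hmean ?_
  calc n * ∫ ω, trunc ((n : ℝ) ^ (1 / p)) (X ω) ^ 2 ∂P
      ≤ n * (1 / 2 * (n : ℝ) ^ (1 / p * (2 - p))) := by gcongr
    _ = 1 / 2 * ((n : ℝ) ^ (1 / p)) ^ 2 := by rw [← hscale]; ring

lemma WeakLawCondition.eventually_half_mul_measureReal_lt_abs_le (h : WeakLawCondition P X p)
    (hp0 : 0 < p) (hp2 : p < 2) (hindep : iIndepFun Xs P)
    (hident : ∀ i, IdentDistrib (Xs i) X P P) (hs : 0 < s) :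
    ∀ᶠ n : ℕ in atTop, 1 / 2 * (n * P.real {ω | (s + 4) * (n : ℝ) ^ (1 / p) < |X ω|}) ≤
      P.real {ω | s * (n : ℝ) ^ (1 / p) < |partialSum Xs n ω|} := by
  filter_upwards [h.tendsto_tail.eventually_le_const (by norm_num : (0 : ℝ) < 1 / 4),
    h.eventually_measureReal_lt_abs_sum_le hp0 hp2 hindep hident] with n htail htight
  have hsum : ∑ i ∈ Finset.range n,
      P.real {ω | s * (n : ℝ) ^ (1 / p) + 4 * (n : ℝ) ^ (1 / p) < |Xs i ω|} =
        n * P.real {ω | (s + 4) * (n : ℝ) ^ (1 / p) < |X ω|} := by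
    simp only [identDistrib_measureReal_lt_abs (hident _), Finset.sum_const, Finset.card_range,
      nsmul_eq_mul, ← add_mul]
  have hjump : n * P.real {ω | (s + 4) * (n : ℝ) ^ (1 / p) < |X ω|} ≤ 1 / 4 := by
    have hlevel : (n : ℝ) ^ (1 / p) ≤ (s + 4) * (n : ℝ) ^ (1 / p) :=
      le_mul_of_one_le_left (by positivity) (by linarith)
    exact (mul_le_mul_of_nonneg_left (measureReal_mono fun ω hω => hlevel.trans_lt hω)
      (Nat.cast_nonneg n)).trans htail
  rw [← hsum] at hjump ⊢
  exact half_sum_measureReal_lt_abs_le (fun i => (hident i).aemeasurable_fst) hindep hjump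
    fun i _ => htight _ ((Finset.card_erase_le).trans_eq (Finset.card_range n))

lemma measureReal_lt_abs_partialSum_le_of_trunc (hindep : iIndepFun Xs P)
    (hident : ∀ i, IdentDistrib (Xs i) X P P) {n : ℕ} {a b l : ℝ} (hs : 0 < s) (hb : 0 ≤ b)
    (hba : b ≤ a) (hl : 0 ≤ l) (hlb : l * b ≤ 1)
    (hmean : n * |∫ ω, trunc a (X ω) ∂P| ≤ s / 4 * a)
    (hvar : n * (l ^ 2 * ∫ ω, trunc b (X ω) ^ 2 ∂P) ≤ 1) :
    P.real {ω | s * a < |partialSum Xs n ω|} ≤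
      (1 + 4 / s) * (n * P.real {ω | b < |X ω|}) + 2 * Real.exp (1 - s / 2 * (l * a)) := by
  have ha : 0 ≤ a := hb.trans hba
  set q := n * P.real {ω | b < |X ω|}
  have hq : 0 ≤ 4 / s * q := by positivity
  have hexp := Real.exp_pos (1 - s / 2 * (l * a))
  rcases le_total (s / 4) q with hsq | hsq
  · have hone : 1 ≤ 4 / s * q := by
      calc (1 : ℝ) = 4 / s * (s / 4) := by field_simp
        _ ≤ 4 / s * q := by gcongr
    linarith [measureReal_le_one (μ := P) (s := {ω | s * a < |partialSum Xs n ω|})]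
  have hmean' : n * (l * |∫ ω, trunc b (X ω) ∂P|) ≤ s / 2 * (l * a) := by
    calc n * (l * |∫ ω, trunc b (X ω) ∂P|)
        ≤ n * (l * (|∫ ω, trunc a (X ω) ∂P| + a * P.real {ω | b < |X ω|})) := by
          gcongr
          exact abs_integral_trunc_le_add (hident 0).aemeasurable_snd ha hba
      _ = l * (n * |∫ ω, trunc a (X ω) ∂P| + a * q) := by ring
      _ ≤ l * (s / 4 * a + a * (s / 4)) := by gcongr
      _ = s / 2 * (l * a) := by ring
  refine (measureReal_lt_abs_sum_le_of_identDistrib hindep hident (Finset.card_range n).le hb hl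
    hlb (s * a)).trans ?_
  have hexponent : -(l * (s * a)) + n * (l * |∫ ω, trunc b (X ω) ∂P| +
      l ^ 2 * ∫ ω, trunc b (X ω) ^ 2 ∂P) ≤ 1 - s / 2 * (l * a) := by
    rw [mul_add]
    linarith
  linarith [Real.exp_le_exp.2 hexponent]

lemma isLittleO_exp_neg_mul_natCast_rpow {δ e : ℝ} (hδ : 0 < δ) (he : 0 < e) (y : ℝ) :
    (fun n : ℕ => Real.exp (-δ * (n : ℝ) ^ e)) =o[atTop] fun n : ℕ => (n : ℝ) ^ y := by
  refine ((isLittleO_exp_neg_mul_rpow_atTop hδ (y / e)).comp_tendsto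
    (tendsto_natCast_rpow_atTop he)).congr_right fun n => ?_
  rw [Function.comp_apply, ← Real.rpow_mul (Nat.cast_nonneg n), mul_div_cancel₀ _ he.ne']

lemma WeakLawCondition.eventually_measureReal_lt_abs_partialSum_le (h : WeakLawCondition P X p)
    (hp0 : 0 < p) (hp2 : p < 2) (hindep : iIndepFun Xs P)
    (hident : ∀ i, IdentDistrib (Xs i) X P P) (hs : 0 < s) {k : ℝ} (hk0 : 0 < k) (hk1 : k < 1)
    (y : ℝ) :
    ∀ᶠ n : ℕ in atTop, P.real {ω | s * (n : ℝ) ^ (1 / p) < |partialSum Xs n ω|} ≤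
      (1 + 4 / s) * (n * P.real {ω | (n : ℝ) ^ (k / p) < |X ω|}) + (n : ℝ) ^ y := by
  have hX : AEMeasurable X P := (hident 0).aemeasurable_snd
  -- With `l = n ^ (e - 1 / p)` this `e` is what makes `n * l ^ 2 * (n ^ (k / p)) ^ (2 - p) = 1`.
  obtain ⟨e, he⟩ : ∃ e, e = (1 - k) * (2 - p) / (2 * p) := ⟨_, rfl⟩
  have he0 : 0 < e := he ▸ div_pos (mul_pos (sub_pos.2 hk1) (sub_pos.2 hp2)) (by positivity)
  have hvar_exponent : 1 + ((e - 1 / p) * 2 + k / p * (2 - p)) = 0 := by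
    rw [he]
    field_simp
    ring
  have hlb_exponent : e - 1 / p + k / p = -((1 - k) / 2) := by
    rw [he]
    field_simp
    ring
  filter_upwards [eventually_ge_atTop 1,
    h.eventually_mul_abs_integral_trunc_le hp0 hX (div_pos hs four_pos),
    h.eventually_integral_trunc_sq_le hp0 hp2 hX (div_pos hk0 hp0) one_pos,
    (isLittleO_exp_neg_mul_natCast_rpow (half_pos hs) he0 y).def
      (by positivity : 0 < (2 * Real.exp 1)⁻¹)] with n hn hmean hvar hexp
  have hn1 : (1 : ℝ) ≤ n := Nat.one_le_cast.2 hn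
  have hn0 : (0 : ℝ) < n := one_pos.trans_le hn1
  refine (measureReal_lt_abs_partialSum_le_of_trunc hindep hident (b := (n : ℝ) ^ (k / p))
    (l := (n : ℝ) ^ (e - 1 / p)) hs (by positivity) (by gcongr) (by positivity) ?_ hmean
    ?_).trans (add_le_add le_rfl ?_)
  · rw [← Real.rpow_add hn0, hlb_exponent]
    exact Real.rpow_le_one_of_one_le_of_nonpos hn1 (by linarith)
  · calc n * (((n : ℝ) ^ (e - 1 / p)) ^ 2 * ∫ ω, trunc ((n : ℝ) ^ (k / p)) (X ω) ^ 2 ∂P)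
        ≤ n * (((n : ℝ) ^ (e - 1 / p)) ^ 2 * (1 * (n : ℝ) ^ (k / p * (2 - p)))) := by gcongr
      _ = (n : ℝ) ^ (1 + ((e - 1 / p) * 2 + k / p * (2 - p))) := by
          rw [Real.rpow_add hn0, Real.rpow_add hn0, Real.rpow_mul hn0.le (e - 1 / p), one_mul,
            Real.rpow_one, Real.rpow_two]
      _ = 1 := by rw [hvar_exponent, Real.rpow_zero]
  · rw [← Real.rpow_add hn0, sub_add_cancel, sub_eq_add_neg, Real.exp_add, ← neg_mul, ← mul_assoc]
    rw [Real.norm_of_nonneg (by positivity), Real.norm_of_nonneg (by positivity)] at hexp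
    exact (le_inv_mul_iff₀ (by positivity)).1 hexp

end

lemma setOf_lt_log_abs {Ω : Type*} (X : Ω → ℝ) {t : ℝ} (ht : 0 ≤ t) :
    {ω | t < Real.log |X ω|} = {ω | Real.exp t < |X ω|} := by
  ext ω
  rcases (abs_nonneg (X ω)).eq_or_lt with h | h
  · simp only [Set.mem_ofPred_eq, ← h, Real.log_zero]
    exact iff_of_false ht.not_gt (Real.exp_nonneg t).not_gt
  · exact Real.lt_log_iff_exp_lt h

lemma exp_mul_log_natCast {n : ℕ} (hn : 0 < n) (c : ℝ) :
    Real.exp (c * Real.log n) = (n : ℝ) ^ c := by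
  rw [Real.rpow_def_of_pos (Nat.cast_pos.2 hn), mul_comm]

section

variable {Ω : Type*} [MeasurableSpace Ω] {P : Measure Ω} [IsFiniteMeasure P]

lemma one_div_mul_log_measure_le_iff {l : ℝ} (hl : 0 < l) (c : ℝ) (A : Set Ω) :
    ((1 / l : ℝ) : EReal) * ENNReal.log (P A) ≤ c ↔ P.real A ≤ Real.exp (c * l) := by
  rw [measureReal_def, ← ENNReal.le_ofReal_iff_toReal_le (measure_ne_top _ _) (Real.exp_nonneg _),
    ← EReal.exp_coe, ← ENNReal.log_le_log_iff, EReal.log_exp, mul_comm c l, EReal.coe_mul,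
    ← EReal.div_le_iff_le_mul (EReal.coe_pos.2 hl) (EReal.coe_ne_top _), EReal.div_eq_inv_mul,
    one_div, EReal.coe_inv]

lemma le_one_div_mul_log_measure_iff {l : ℝ} (hl : 0 < l) (c : ℝ) (A : Set Ω) :
    (c : EReal) ≤ ((1 / l : ℝ) : EReal) * ENNReal.log (P A) ↔ Real.exp (c * l) ≤ P.real A := by
  rw [measureReal_def, ← ENNReal.ofReal_le_iff_le_toReal (measure_ne_top _ _), ← EReal.exp_coe,
    ← ENNReal.log_le_log_iff, EReal.log_exp, EReal.coe_mul,
    ← EReal.le_div_iff_mul_le (EReal.coe_pos.2 hl) (EReal.coe_ne_top _), EReal.div_eq_inv_mul,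
    one_div, EReal.coe_inv]

lemma logTailRate_le_iff (X : Ω → ℝ) {t : ℝ} (ht : 0 < t) (c : ℝ) :
    logTailRate P X t ≤ c ↔ P.real {ω | Real.exp t < |X ω|} ≤ Real.exp (c * t) := by
  rw [logTailRate, one_div_mul_log_measure_le_iff ht, setOf_lt_log_abs X ht.le]

lemma le_logTailRate_iff (X : Ω → ℝ) {t : ℝ} (ht : 0 < t) (c : ℝ) :
    c ≤ logTailRate P X t ↔ Real.exp (c * t) ≤ P.real {ω | Real.exp t < |X ω|} := by
  rw [logTailRate, le_one_div_mul_log_measure_iff ht, setOf_lt_log_abs X ht.le]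

lemma logTailRate_mul_log_le_iff (X : Ω → ℝ) {α : ℝ} (hα : 0 < α) {n : ℕ} (hn : 1 < n) (c : ℝ) :
    logTailRate P X (α * Real.log n) ≤ c ↔
      P.real {ω | (n : ℝ) ^ α < |X ω|} ≤ (n : ℝ) ^ (c * α) := by
  rw [logTailRate_le_iff X (mul_pos hα (Real.log_pos (Nat.one_lt_cast.2 hn))), ← mul_assoc,
    exp_mul_log_natCast (one_pos.trans hn), exp_mul_log_natCast (one_pos.trans hn)]

lemma le_logTailRate_mul_log_iff (X : Ω → ℝ) {α : ℝ} (hα : 0 < α) {n : ℕ} (hn : 1 < n) (c : ℝ) :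
    c ≤ logTailRate P X (α * Real.log n) ↔
      (n : ℝ) ^ (c * α) ≤ P.real {ω | (n : ℝ) ^ α < |X ω|} := by
  rw [le_logTailRate_iff X (mul_pos hα (Real.log_pos (Nat.one_lt_cast.2 hn))), ← mul_assoc,
    exp_mul_log_natCast (one_pos.trans hn), exp_mul_log_natCast (one_pos.trans hn)]

lemma logDeviationRate_le_iff (Xs : ℕ → Ω → ℝ) (p s : ℝ) {n : ℕ} (hn : 1 < n) (c : ℝ) :
    logDeviationRate P Xs p s n ≤ c ↔
      P.real {ω | s * (n : ℝ) ^ (1 / p) < |partialSum Xs n ω|} ≤ (n : ℝ) ^ c := by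
  rw [logDeviationRate, one_div_mul_log_measure_le_iff (Real.log_pos (Nat.one_lt_cast.2 hn)),
    exp_mul_log_natCast (one_pos.trans hn)]

lemma le_logDeviationRate_iff (Xs : ℕ → Ω → ℝ) (p s : ℝ) {n : ℕ} (hn : 1 < n) (c : ℝ) :
    c ≤ logDeviationRate P Xs p s n ↔
      (n : ℝ) ^ c ≤ P.real {ω | s * (n : ℝ) ^ (1 / p) < |partialSum Xs n ω|} := by
  rw [logDeviationRate, le_one_div_mul_log_measure_iff (Real.log_pos (Nat.one_lt_cast.2 hn)),
    exp_mul_log_natCast (one_pos.trans hn)]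

end

section

lemma tendsto_exp_div_atTop {α : ℝ} (hα : 0 < α) :
    Tendsto (fun t : ℝ => Real.exp (t / α)) atTop atTop :=
  Real.tendsto_exp_atTop.comp (tendsto_id.atTop_div_const hα)

lemma tendsto_mul_log_sub_of_tendsto_div {α : ℝ} (hα : 0 < α) {ν : ℝ → ℕ}
    (hν : Tendsto (fun x : ℝ => (ν x : ℝ) / x) atTop (𝓝 1)) :
    Tendsto (fun t : ℝ => α * Real.log (ν (Real.exp (t / α))) - t) atTop (𝓝 0) := by
  have hratio : Tendsto (fun t : ℝ => (ν (Real.exp (t / α)) : ℝ) / Real.exp (t / α)) atTop (𝓝 1) :=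
    hν.comp (tendsto_exp_div_atTop hα)
  have hlog := ((Real.continuousAt_log one_ne_zero).tendsto.comp hratio).const_mul α
  rw [Real.log_one, mul_zero] at hlog
  refine hlog.congr' ?_
  filter_upwards [hratio.eventually_ne one_ne_zero] with t ht
  rw [Function.comp_apply, Real.log_div (div_ne_zero_iff.1 ht).1 (Real.exp_ne_zero _),
    Real.log_exp, mul_sub, mul_div_cancel₀ _ hα.ne']

lemma eventually_mul_le_mul_of_tendsto_sub {u : ℝ → ℝ}
    (hu : Tendsto (fun t => u t - t) atTop (𝓝 0)) {c c' : ℝ} (hc : c < c') :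
    ∀ᶠ t in atTop, c * t ≤ c' * u t := by
  have hdiff : Tendsto (fun t => (c' - c) * t + c' * (u t - t)) atTop atTop :=
    (tendsto_id.const_mul_atTop (sub_pos.2 hc)).atTop_add (hu.const_mul c')
  filter_upwards [hdiff.eventually_ge_atTop 0] with t ht
  linarith

variable {Ω : Type*} [MeasurableSpace Ω] {P : Measure Ω} [IsFiniteMeasure P] {u : ℝ → ℝ}

lemma measureReal_exp_lt_abs_anti (X : Ω → ℝ) :
    Antitone fun t : ℝ => P.real {ω | Real.exp t < |X ω|} :=
  fun _ _ htu => measureReal_mono fun _ hω => (Real.exp_le_exp.2 htu).trans_lt hω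

lemma eventually_logTailRate_le_of_le (X : Ω → ℝ) (hu : Tendsto (fun t => u t - t) atTop (𝓝 0))
    (hle : ∀ t, t ≤ u t) {c c' : ℝ} (hc : c < c') :
    ∀ᶠ t in atTop, logTailRate P X t ≤ c → logTailRate P X (u t) ≤ c' := by
  filter_upwards [eventually_gt_atTop 0, eventually_mul_le_mul_of_tendsto_sub hu hc] with t ht0 hct
  rw [logTailRate_le_iff X ht0, logTailRate_le_iff X (ht0.trans_le (hle t))]
  intro ht
  exact (measureReal_exp_lt_abs_anti X (hle t)).trans (ht.trans (Real.exp_le_exp.2 hct))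

lemma eventually_le_logTailRate_of_le (X : Ω → ℝ) (hu : Tendsto (fun t => u t - t) atTop (𝓝 0))
    (hle : ∀ᶠ t in atTop, u t ≤ t) {c c' : ℝ} (hc : c' < c) :
    ∀ᶠ t in atTop, c ≤ logTailRate P X t → c' ≤ logTailRate P X (u t) := by
  filter_upwards [eventually_gt_atTop 1, hu.eventually_const_lt (by norm_num : (-1 : ℝ) < 0),
    hle, eventually_mul_le_mul_of_tendsto_sub hu (neg_lt_neg hc)] with t ht1 hut hle hct
  rw [le_logTailRate_iff X (by linarith), le_logTailRate_iff X (by linarith)]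
  intro ht
  refine (Real.exp_le_exp.2 ?_).trans (ht.trans (measureReal_exp_lt_abs_anti X hle))
  linarith

lemma tendsto_mul_log_natCast {α : ℝ} (hα : 0 < α) :
    Tendsto (fun n : ℕ => α * Real.log n) atTop atTop :=
  (Real.tendsto_log_atTop.comp tendsto_natCast_atTop_atTop).const_mul_atTop hα

lemma limsup_logTailRate_mul_log (X : Ω → ℝ) {α : ℝ} (hα : 0 < α) :
    limsup (fun n : ℕ => logTailRate P X (α * Real.log n)) atTop =
      limsup (logTailRate P X) atTop := by
  refine le_antisymm
    ((tendsto_mul_log_natCast hα).limsup_comp_le_limsup (u := logTailRate P X))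
    (EReal.ge_of_forall_gt_iff_ge.1 fun c' hc' => ?_)
  obtain ⟨c, hcc', hc⟩ := EReal.lt_iff_exists_real_btwn.1 hc'
  have hfloor : ∀ᶠ t : ℝ in atTop, α * Real.log ⌊Real.exp (t / α)⌋₊ ≤ t := by
    filter_upwards [eventually_ge_atTop 0] with t ht
    have hpos : (0 : ℝ) < ⌊Real.exp (t / α)⌋₊ :=
      Nat.cast_pos.2 (Nat.floor_pos.2 (Real.one_le_exp (by positivity)))
    rw [← le_div_iff₀' hα]
    exact (Real.log_le_iff_le_exp hpos).2 (Nat.floor_le (Real.exp_nonneg _))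
  have hfreq : ∃ᶠ t : ℝ in atTop,
      (c' : EReal) ≤ logTailRate P X (α * Real.log ⌊Real.exp (t / α)⌋₊) :=
    ((frequently_lt_of_lt_limsup (h := hc)).and_eventually (eventually_le_logTailRate_of_le X
      (tendsto_mul_log_sub_of_tendsto_div hα tendsto_nat_floor_div_atTop) hfloor
      (EReal.coe_lt_coe_iff.1 hcc'))).mono fun t ht => ht.2 ht.1.le
  exact le_limsup_of_frequently_le'
    ((tendsto_nat_floor_atTop.comp (tendsto_exp_div_atTop hα)).frequently
      (p := fun n : ℕ => (c' : EReal) ≤ logTailRate P X (α * Real.log n)) hfreq)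

lemma liminf_logTailRate_mul_log (X : Ω → ℝ) {α : ℝ} (hα : 0 < α) :
    liminf (fun n : ℕ => logTailRate P X (α * Real.log n)) atTop =
      liminf (logTailRate P X) atTop := by
  refine le_antisymm (EReal.le_of_forall_lt_iff_le.1 fun c' hc' => ?_)
    ((tendsto_mul_log_natCast hα).liminf_le_liminf_comp (u := logTailRate P X))
  obtain ⟨c, hc, hcc'⟩ := EReal.lt_iff_exists_real_btwn.1 hc'
  have hceil : ∀ t : ℝ, t ≤ α * Real.log ⌈Real.exp (t / α)⌉₊ := by
    intro t
    have hpos : (0 : ℝ) < ⌈Real.exp (t / α)⌉₊ := Nat.cast_pos.2 (Nat.ceil_pos.2 (Real.exp_pos _))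
    rw [← div_le_iff₀' hα]
    exact (Real.le_log_iff_exp_le hpos).2 (Nat.le_ceil _)
  have hfreq : ∃ᶠ t : ℝ in atTop, logTailRate P X (α * Real.log ⌈Real.exp (t / α)⌉₊) ≤ c' :=
    ((frequently_lt_of_liminf_lt (h := hc)).and_eventually (eventually_logTailRate_le_of_le X
      (tendsto_mul_log_sub_of_tendsto_div hα tendsto_nat_ceil_div_atTop) hceil
      (EReal.coe_lt_coe_iff.1 hcc'))).mono fun t ht => ht.2 ht.1.le
  exact liminf_le_of_frequently_le'
    ((tendsto_nat_ceil_atTop.comp (tendsto_exp_div_atTop hα)).frequently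
      (p := fun n : ℕ => logTailRate P X (α * Real.log n) ≤ c') hfreq)

end

section

variable {Ω : Type*} [MeasurableSpace Ω] {P : Measure Ω} [IsProbabilityMeasure P] {X : Ω → ℝ}
  {Xs : ℕ → Ω → ℝ} {p s : ℝ}

lemma eventually_mul_natCast_rpow_le {x y : ℝ} (hxy : x < y) (K : ℝ) :
    ∀ᶠ n : ℕ in atTop, K * (n : ℝ) ^ x ≤ (n : ℝ) ^ y := by
  filter_upwards [(tendsto_natCast_rpow_atTop (sub_pos.2 hxy)).eventually_ge_atTop K,
    eventually_gt_atTop 0] with n hn hn0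
  calc K * (n : ℝ) ^ x ≤ (n : ℝ) ^ (y - x) * (n : ℝ) ^ x := by gcongr
    _ = (n : ℝ) ^ y := by rw [← Real.rpow_add (Nat.cast_pos.2 hn0), sub_add_cancel]

lemma WeakLawCondition.exists_eventually_logDeviationRate_le (h : WeakLawCondition P X p)
    (hp0 : 0 < p) (hp2 : p < 2) (hindep : iIndepFun Xs P)
    (hident : ∀ i, IdentDistrib (Xs i) X P P) (hs : 0 < s) {c c' : ℝ} (hc : c < c') :
    ∃ α > 0, ∀ᶠ n : ℕ in atTop, logTailRate P X (α * Real.log n) ≤ c →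
      logDeviationRate P Xs p s n ≤ (1 + c' / p : ℝ) := by
  obtain ⟨k, hkc, hk0, hk1⟩ : ∃ k : ℝ, c * k < c' ∧ 0 < k ∧ k < 1 := by
    have hmul : Tendsto (c * ·) (𝓝[<] 1) (𝓝 c) :=
      ((continuous_const_mul c).tendsto' 1 c (mul_one c)).mono_left nhdsWithin_le_nhds
    exact ((hmul.eventually_lt_const hc).and (Ioo_mem_nhdsLT one_pos)).exists
  have hexponent : 1 + c * (k / p) < 1 + c' / p := by
    rw [← mul_div_assoc]
    gcongr
  refine ⟨k / p, div_pos hk0 hp0, ?_⟩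
  filter_upwards [h.eventually_measureReal_lt_abs_partialSum_le hp0 hp2 hindep hident hs hk0 hk1
      (c' / p), eventually_ge_atTop 2, eventually_mul_natCast_rpow_le hexponent (2 * (1 + 4 / s))]
    with n hsum hn hpow
  have hn0 : (0 : ℝ) < n := Nat.cast_pos.2 (two_pos.trans_le hn)
  rw [logTailRate_mul_log_le_iff X (div_pos hk0 hp0) hn, logDeviationRate_le_iff Xs p s hn]
  intro htail
  have hn2 : 2 * (n : ℝ) ^ (c' / p) ≤ (n : ℝ) ^ (1 + c' / p) := by
    rw [Real.rpow_add hn0, Real.rpow_one]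
    gcongr
    exact Nat.ofNat_le_cast.2 hn
  calc P.real {ω | s * (n : ℝ) ^ (1 / p) < |partialSum Xs n ω|}
      ≤ (1 + 4 / s) * (n * (n : ℝ) ^ (c * (k / p))) + (n : ℝ) ^ (c' / p) := by
        refine hsum.trans ?_
        gcongr
    _ = (1 + 4 / s) * (n : ℝ) ^ (1 + c * (k / p)) + (n : ℝ) ^ (c' / p) := by
        rw [Real.rpow_add hn0, Real.rpow_one]
    _ ≤ (n : ℝ) ^ (1 + c' / p) := by linarith

lemma WeakLawCondition.exists_eventually_le_logDeviationRate (h : WeakLawCondition P X p)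
    (hp0 : 0 < p) (hp2 : p < 2) (hindep : iIndepFun Xs P)
    (hident : ∀ i, IdentDistrib (Xs i) X P P) (hs : 0 < s) {c c' : ℝ} (hc : c' < c) :
    ∃ α > 0, ∀ᶠ n : ℕ in atTop, c ≤ logTailRate P X (α * Real.log n) →
      (1 + c' / p : ℝ) ≤ logDeviationRate P Xs p s n := by
  obtain ⟨k, hkc, hk1⟩ : ∃ k : ℝ, c' < c * k ∧ 1 < k := by
    have hmul : Tendsto (c * ·) (𝓝[>] 1) (𝓝 c) :=
      ((continuous_const_mul c).tendsto' 1 c (mul_one c)).mono_left nhdsWithin_le_nhds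
    exact ((hmul.eventually_const_lt hc).and self_mem_nhdsWithin).exists
  have hexponent : 1 + c' / p < 1 + c * (k / p) := by
    rw [← mul_div_assoc]
    gcongr
  have hkp : 1 / p < k / p := by gcongr
  have hk0 : 0 < k / p := (one_div_pos.2 hp0).trans hkp
  refine ⟨k / p, hk0, ?_⟩
  filter_upwards [h.eventually_half_mul_measureReal_lt_abs_le hp0 hp2 hindep hident hs,
    eventually_ge_atTop 2, eventually_mul_natCast_rpow_le hexponent 2,
    eventually_mul_natCast_rpow_le hkp (s + 4)] with n hsum hn hpow hlevel
  have hn0 : (0 : ℝ) < n := Nat.cast_pos.2 (two_pos.trans_le hn)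
  rw [le_logTailRate_mul_log_iff X hk0 hn, le_logDeviationRate_iff Xs p s hn]
  intro htail
  calc (n : ℝ) ^ (1 + c' / p) ≤ 1 / 2 * (n : ℝ) ^ (1 + c * (k / p)) := by linarith
    _ = 1 / 2 * (n * (n : ℝ) ^ (c * (k / p))) := by rw [Real.rpow_add hn0, Real.rpow_one]
    _ ≤ 1 / 2 * (n * P.real {ω | (s + 4) * (n : ℝ) ^ (1 / p) < |X ω|}) := by
        gcongr
        exact htail.trans (measureReal_mono fun ω hω => hlevel.trans_lt hω)
    _ ≤ P.real {ω | s * (n : ℝ) ^ (1 / p) < |partialSum Xs n ω|} := hsum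

end

section

variable {p : ℝ} {x β : EReal}

lemma neg_sub_div_lt_coe_iff (hp : 0 < p) (c : ℝ) :
    -(β - (p : EReal)) / (p : EReal) < (1 + c / p : ℝ) ↔ -β < c := by
  have hscale : (1 + c / p) * p = p + c := by field_simp
  rw [EReal.div_lt_iff (EReal.coe_pos.2 hp) (EReal.coe_ne_top p),
    ← EReal.coe_mul, hscale]
  induction β with
  | bot => simp
  | top => simp
  | coe b =>
    norm_cast
    constructor <;> intro h <;> linarith

lemma coe_lt_neg_sub_div_iff (hp : 0 < p) (c : ℝ) :
    (1 + c / p : ℝ) < -(β - (p : EReal)) / (p : EReal) ↔ c < -β := by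
  have hscale : (1 + c / p) * p = p + c := by field_simp
  rw [EReal.lt_div_iff (EReal.coe_pos.2 hp) (EReal.coe_ne_top p),
    ← EReal.coe_mul, hscale]
  induction β with
  | bot => simp [-EReal.coe_add]
  | top => simp
  | coe b =>
    norm_cast
    constructor <;> intro h <;> linarith

lemma strictAnti_neg_sub_div (hp : 0 < p) :
    StrictAnti fun β : EReal => -(β - (p : EReal)) / (p : EReal) := by
  intro β β' h
  obtain ⟨c, hc', hc⟩ := EReal.lt_iff_exists_real_btwn.1 (EReal.neg_lt_neg_iff.2 h)
  exact ((neg_sub_div_lt_coe_iff hp c).2 hc').trans ((coe_lt_neg_sub_div_iff hp c).2 hc)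

lemma eq_neg_sub_div_of_forall_coe (hp : 0 < p) (hle : ∀ c : ℝ, -β < c → x ≤ (1 + c / p : ℝ))
    (hge : ∀ c : ℝ, c < -β → (1 + c / p : ℝ) ≤ x) :
    x = -(β - (p : EReal)) / (p : EReal) := by
  have hcoe : ∀ d : ℝ, d = 1 + p * (d - 1) / p := fun d => by
    field_simp
    ring
  refine le_antisymm (EReal.le_of_forall_lt_iff_le.1 fun d hd => ?_)
    (EReal.ge_of_forall_gt_iff_ge.1 fun d hd => ?_)
  · rw [hcoe d] at hd ⊢
    exact hle _ ((neg_sub_div_lt_coe_iff hp _).1 hd)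
  · rw [hcoe d] at hd ⊢
    exact hge _ ((coe_lt_neg_sub_div_iff hp _).1 hd)

end

section

variable {Ω : Type*} [MeasurableSpace Ω] {P : Measure Ω} [IsProbabilityMeasure P] {X : Ω → ℝ}
  {Xs : ℕ → Ω → ℝ} {p s : ℝ}

lemma WeakLawCondition.limsup_logDeviationRate (h : WeakLawCondition P X p) (hp0 : 0 < p)
    (hp2 : p < 2) (hindep : iIndepFun Xs P) (hident : ∀ i, IdentDistrib (Xs i) X P P)
    (hs : 0 < s) :
    limsup (logDeviationRate P Xs p s) atTop =
      -(betaUpper P X - (p : EReal)) / (p : EReal) := by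
  refine eq_neg_sub_div_of_forall_coe hp0 (fun c' hc' => ?_) (fun c' hc' => ?_)
  · obtain ⟨c, hc₁, hc₂⟩ := EReal.lt_iff_exists_real_btwn.1 hc'
    obtain ⟨α, hα, hrate⟩ := h.exists_eventually_logDeviationRate_le hp0 hp2 hindep hident hs
      (EReal.coe_lt_coe_iff.1 hc₂)
    rw [betaUpper, neg_neg, ← limsup_logTailRate_mul_log X hα] at hc₁
    refine limsup_le_of_le (h := ?_)
    filter_upwards [hrate, eventually_lt_of_limsup_lt hc₁] with n hn htail using hn htail.le
  · obtain ⟨c, hc₁, hc₂⟩ := EReal.lt_iff_exists_real_btwn.1 hc'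
    obtain ⟨α, hα, hrate⟩ := h.exists_eventually_le_logDeviationRate hp0 hp2 hindep hident hs
      (EReal.coe_lt_coe_iff.1 hc₁)
    rw [betaUpper, neg_neg, ← limsup_logTailRate_mul_log X hα] at hc₂
    exact le_limsup_of_frequently_le' (((frequently_lt_of_lt_limsup (h := hc₂)).and_eventually
      hrate).mono fun n hn => hn.2 hn.1.le)

lemma WeakLawCondition.liminf_logDeviationRate (h : WeakLawCondition P X p) (hp0 : 0 < p)
    (hp2 : p < 2) (hindep : iIndepFun Xs P) (hident : ∀ i, IdentDistrib (Xs i) X P P)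
    (hs : 0 < s) :
    liminf (logDeviationRate P Xs p s) atTop =
      -(betaLower P X - (p : EReal)) / (p : EReal) := by
  refine eq_neg_sub_div_of_forall_coe hp0 (fun c' hc' => ?_) (fun c' hc' => ?_)
  · obtain ⟨c, hc₁, hc₂⟩ := EReal.lt_iff_exists_real_btwn.1 hc'
    obtain ⟨α, hα, hrate⟩ := h.exists_eventually_logDeviationRate_le hp0 hp2 hindep hident hs
      (EReal.coe_lt_coe_iff.1 hc₂)
    rw [betaLower, neg_neg, ← liminf_logTailRate_mul_log X hα] at hc₁
    exact liminf_le_of_frequently_le' (((frequently_lt_of_liminf_lt (h := hc₁)).and_eventually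
      hrate).mono fun n hn => hn.2 hn.1.le)
  · obtain ⟨c, hc₁, hc₂⟩ := EReal.lt_iff_exists_real_btwn.1 hc'
    obtain ⟨α, hα, hrate⟩ := h.exists_eventually_le_logDeviationRate hp0 hp2 hindep hident hs
      (EReal.coe_lt_coe_iff.1 hc₁)
    rw [betaLower, neg_neg, ← liminf_logTailRate_mul_log X hα] at hc₂
    refine le_liminf_of_le (h := ?_)
    filter_upwards [hrate, eventually_lt_of_lt_liminf hc₂] with n hn htail using hn htail.le

end

theorem theorem2p2 {Ω : Type*} [MeasurableSpace Ω] (P : Measure Ω) [IsProbabilityMeasure P]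
    (p : ℝ) (hp0 : 0 < p) (hp2 : p < 2)
    (X : Ω → ℝ) (Xs : ℕ → Ω → ℝ)
    (hX : Measurable X) (hXs : ∀ n, Measurable (Xs n))
    (hindep : iIndepFun Xs P) (hident : ∀ n, IdentDistrib (Xs n) X P P)
    (hwlln : WeakLawCondition P X p) :
    ∀ s : ℝ, 0 < s →
      limsup (fun n : ℕ => logDeviationRate P Xs p s n) atTop
          = -(betaUpper P X - (p : EReal)) / (p : EReal) ∧
      liminf (fun n : ℕ => logDeviationRate P Xs p s n) atTop
          = -(betaLower P X - (p : EReal)) / (p : EReal) ∧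
      ∀ β : EReal,
        Tendsto (fun n : ℕ => logDeviationRate P Xs p s n) atTop
            (𝓝 (-(β - (p : EReal)) / (p : EReal))) ↔
          betaUpper P X = β ∧ betaLower P X = β := by
  intro s hs
  have hlimsup := hwlln.limsup_logDeviationRate hp0 hp2 hindep hident hs
  have hliminf := hwlln.liminf_logDeviationRate hp0 hp2 hindep hident hs
  have hinj := (strictAnti_neg_sub_div hp0).injective
  refine ⟨hlimsup, hliminf, fun β => ⟨fun hlim => ?_, ?_⟩⟩
  · exact ⟨hinj (hlimsup.symm.trans hlim.limsup_eq), hinj (hliminf.symm.trans hlim.liminf_eq)⟩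
  · rintro ⟨rfl, hlower⟩
    exact tendsto_of_le_liminf_of_limsup_le (hlower ▸ hliminf).ge hlimsup.le
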